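/- Let $M\ge 2$, $n\ge 1$, $d\ge 1$ be integers, let $L>0$, and let $x\ge 0$ be a real number such that $$\frac{\log M+x}{n}<3 .$$ Let $\mathcal F$ be the class of all probability densities $f$ with respect to the Lebesgue measure on $\mathbb R^d$ with $\|f\|_\infty\le L$, and let $\|\cdot\|$ be the norm of $L^2(\mathbb R^d)$. An estimator is a Borel measurable map $\hat T_n:(\mathbb R^d)^n\to L^2(\mathbb R^d)$, evaluated at the observations $X_1,\dots,X_n$; for $f\in\mathcal F$, $\mathbb P_f$ denotes the probability when $X_1,\dots,X_n$ are i.i.d. with density $f$. Then there exist $f_1,\dots,f_M\in L^2(\mathbb R^d)$ with $\|f_j\|_\infty\le L$ for all $j$ such that for every estimator $\hat T_n$ there is a density $f\in\mathcal F$ with $$\mathbb P_f\left(\|\hat T_n-f\|^2-\min_{j=1,\dots,M}\|f_j-f\|^2>\frac{L}{24}\cdot\frac{\log M+x}{n}\right)\ \ge\ \frac1{24}\,e^{-x}.$$ In particular, $\inf_{\hat T_n}\sup_{f\in\mathcal F}\mathbb P_f(\,\cdots)\ge\frac1{24}e^{-x}$ for the same event, the infimum being over all estimators. -/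

import Mathlib

open MeasureTheory

/-- The real Hilbert space `L²(ℝ^d)` with respect to Lebesgue measure. -/
abbrev L2Space (d : ℕ) : Type :=
  Lp ℝ 2 (volume : Measure (EuclideanSpace ℝ (Fin d)))

/-- `g` has essential supremum norm at most `L`. -/
def SupNormLE {d : ℕ} (L : ℝ) (g : L2Space d) : Prop :=
  eLpNorm g ⊤ volume ≤ ENNReal.ofReal L

/-- The class of all probability densities on `ℝ^d`, with respect to Lebesgue measure, that are
bounded by `L`. Densities are taken up to almost everywhere equality; a bounded density is
automatically square integrable, so that the class is a subset of `L²(ℝ^d)`. -/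
def boundedDensities (d : ℕ) (L : ℝ) : Set (L2Space d) :=
  {f | (∀ᵐ u, 0 ≤ f u) ∧ ∫⁻ u, ENNReal.ofReal (f u) = 1 ∧ SupNormLE L f}

/-- The joint law of `n` i.i.d. observations with density `f`. -/
noncomputable def sampleLaw {d : ℕ} (n : ℕ) (f : L2Space d) :
    Measure (Fin n → EuclideanSpace ℝ (Fin d)) :=
  Measure.pi fun _ => volume.withDensity fun u => ENNReal.ofReal (f u)

/-- An estimator based on `n` observations in `ℝ^d`: a Borel measurable function of the
observations with values in `L²(ℝ^d)`. -/
def IsEstimator {d n : ℕ} (T : (Fin n → EuclideanSpace ℝ (Fin d)) → L2Space d) : Prop :=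
  Measurable[_, borel (L2Space d)] T

/-- The excess squared `L²` risk of `g` over the dictionary `F`, when the density is `f`. -/
noncomputable def excessRisk {d M : ℕ} (F : Fin M → L2Space d) (f g : L2Space d) : ℝ :=
  ‖g - f‖ ^ 2 - ⨅ j, ‖F j - f‖ ^ 2

open scoped ENNReal

/-! ### Product measures and the second moment method -/

/-! Write `l = (log M + x) / n`. The dictionary consists of the densities `L/2 * (1 + γ σ_j)`, where
the signs `σ_j` are independent and balanced on `2 ^ M` cells of total volume `2 / L`. When the
truth is a member of the dictionary, the oracle term vanishes and the excess risk is a squared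
distance (`excessRisk_apply_self`).

The members lie at squared distance `L γ²`, so the events that the estimator is close to `f_j` are
disjoint and estimation becomes testing. Cauchy–Schwarz for the likelihood ratio
(`sampleLaw_stepLp_sq_le`) bounds `P_j(A)²` by `P_k(A)` times the `n`-th power of the
one-observation second moment `(1 + γ²) / (1 - γ²)`. With `γ² = l / 5` this power is at most `exp (n
l) = M exp x`, and `exists_le_measure_compl` concludes. -/

theorem lintegral_pi_fin_prod_eq_prod {n : ℕ} {E : Fin n → Type*}
    {mE : ∀ i, MeasurableSpace (E i)} {μ : (i : Fin n) → Measure (E i)} [∀ i, SigmaFinite (μ i)]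
    {f : (i : Fin n) → E i → ℝ≥0∞} (hf : ∀ i, Measurable (f i)) :
    ∫⁻ x : (i : Fin n) → E i, ∏ i, f i (x i) ∂(Measure.pi μ) = ∏ i, ∫⁻ x, f i x ∂(μ i) := by
  induction n with
  | zero => simp
  | succ n n_ih =>
    have hm : Measurable fun y : (i : Fin n) → E i.succ => ∏ i : Fin n, f i.succ (y i) :=
      Finset.measurable_prod _ fun i _ => (hf i.succ).comp (measurable_pi_apply i)
    calc
      _ = ∫⁻ x : E 0 × ((i : Fin n) → E i.succ),
            f 0 x.1 * ∏ i : Fin n, f i.succ (x.2 i)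
            ∂((μ 0).prod (Measure.pi fun i => μ i.succ)) := by
          rw [← ((measurePreserving_piFinSuccAbove μ 0).symm).lintegral_comp_emb
            (MeasurableEquiv.measurableEmbedding _)]
          simp_rw [MeasurableEquiv.piFinSuccAbove_symm_apply, Fin.insertNthEquiv,
            Fin.prod_univ_succ, Fin.insertNth_zero, Equiv.coe_fn_mk, Fin.cons_succ,
            Fin.zero_succAbove, Fin.cons_zero]
          rfl
      _ = (∫⁻ x, f 0 x ∂μ 0) * ∏ i : Fin n, ∫⁻ x, f i.succ x ∂(μ i.succ) := by
          rw [← n_ih fun i => hf i.succ,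
            ← lintegral_prod_mul (hf 0).aemeasurable hm.aemeasurable]
      _ = ∏ i, ∫⁻ x, f i x ∂(μ i) := by rw [Fin.prod_univ_succ]

theorem pi_withDensity_eq {n : ℕ} {E : Type*} [MeasurableSpace E] (μ : Measure E) [SigmaFinite μ]
    {ρ : E → ℝ≥0∞} (hρ : Measurable ρ) [SigmaFinite (μ.withDensity ρ)] :
    (Measure.pi fun _ : Fin n => μ.withDensity ρ) =
      (Measure.pi fun _ : Fin n => μ).withDensity fun X => ∏ i, ρ (X i) := by
  refine Measure.pi_eq fun s hs => ?_
  rw [withDensity_apply _ (MeasurableSet.univ_pi hs), Measure.restrict_pi_pi,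
    lintegral_pi_fin_prod_eq_prod (f := fun _ => ρ) fun _ => hρ]
  exact Finset.prod_congr rfl fun i _ => (withDensity_apply _ (hs i)).symm

/-- Cauchy–Schwarz applied to `1 * ρ` on `A`. -/
theorem withDensity_apply_sq_le {Ω : Type*} [MeasurableSpace Ω] (μ : Measure Ω) {ρ : Ω → ℝ≥0∞}
    (hρ : Measurable ρ) {A : Set Ω} (hA : MeasurableSet A) :
    μ.withDensity ρ A ^ 2 ≤ μ A * ∫⁻ u, ρ u ^ 2 ∂μ := by
  have h := ENNReal.lintegral_mul_le_Lp_mul_Lq (μ.restrict A)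
    (Real.HolderConjugate.two_two) (f := 1) (g := ρ) aemeasurable_const hρ.aemeasurable
  rw [withDensity_apply _ hA]
  simp only [one_mul, Pi.one_apply, ENNReal.one_rpow, lintegral_const, Measure.restrict_apply,
    MeasurableSet.univ, Set.univ_inter] at h
  calc (∫⁻ u in A, ρ u ∂μ) ^ 2
      ≤ (μ A ^ (1 / 2 : ℝ) * (∫⁻ u in A, ρ u ^ (2 : ℝ) ∂μ) ^ (1 / 2 : ℝ)) ^ 2 := by gcongr
    _ = μ A * ∫⁻ u in A, ρ u ^ 2 ∂μ := by
        rw [mul_pow]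
        simp only [← ENNReal.rpow_natCast, ← ENNReal.rpow_mul]
        norm_num
    _ ≤ μ A * ∫⁻ u, ρ u ^ 2 ∂μ := by
        gcongr
        exact Measure.restrict_le_self

/-- The likelihood ratio of the samples is a product over the observations, so its second moment is
an `n`-th power. -/
theorem pi_withDensity_apply_sq_le {n : ℕ} {E : Type*} [MeasurableSpace E] (μ : Measure E)
    [SigmaFinite μ] {ρ : E → ℝ≥0∞} (hρ : Measurable ρ) [SigmaFinite (μ.withDensity ρ)]
    {A : Set (Fin n → E)} (hA : MeasurableSet A) :
    (Measure.pi fun _ : Fin n => μ.withDensity ρ) A ^ 2 ≤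
      (Measure.pi fun _ : Fin n => μ) A * (∫⁻ u, ρ u ^ 2 ∂μ) ^ n := by
  rw [pi_withDensity_eq μ hρ]
  have hm : Measurable fun X : Fin n → E => ∏ i, ρ (X i) :=
    Finset.measurable_prod _ fun i _ => hρ.comp (measurable_pi_apply i)
  refine (withDensity_apply_sq_le _ hm hA).trans_eq ?_
  simp_rw [← Finset.prod_pow]
  rw [lintegral_pi_fin_prod_eq_prod (f := fun _ u => ρ u ^ 2) fun _ => hρ.pow_const 2]
  simp

/-- If the likelihood ratios of `M` laws have second moment at most `M * exp x`, then any test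
between them errs with probability at least `exp (-x) / 24` under one of the laws. -/
theorem exists_le_measure_compl {Ω : Type*} [MeasurableSpace Ω] {M : ℕ} (hM : 2 ≤ M) {x : ℝ}
    (hx : 0 ≤ x) (Q : Fin M → Measure Ω) [∀ j, IsProbabilityMeasure (Q j)] (A : Fin M → Set Ω)
    (hA : ∀ j, MeasurableSet (A j)) (hd : Pairwise (Function.onFun Disjoint A))
    (hQ : ∀ j k, j ≠ k → Q j (A j) ^ 2 ≤ Q k (A j) * ENNReal.ofReal (M * Real.exp x)) :
    ∃ j, ENNReal.ofReal (1 / 24 * Real.exp (-x)) ≤ Q j (A j)ᶜ := by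
  by_contra! hlt
  have hlt' (j) : (Q j).real (A j)ᶜ < 1 / 24 * Real.exp (-x) :=
    (ENNReal.lt_ofReal_iff_toReal_lt (measure_ne_top _ _)).1 (hlt j)
  have hQ' (j k) (hjk : j ≠ k) :
      (Q j).real (A j) ^ 2 ≤ (Q k).real (A j) * (M * Real.exp x) := by
    have := ENNReal.toReal_mono (ENNReal.mul_ne_top (measure_ne_top _ _) ENNReal.ofReal_ne_top)
      (hQ j k hjk)
    rwa [ENNReal.toReal_pow, ENNReal.toReal_mul, ENNReal.toReal_ofReal (by positivity)] at this
  have hex : Real.exp (-x) ≤ 1 := Real.exp_le_one_iff.2 (by linarith)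
  have hlow (j) : (23 / 24 : ℝ) ^ 2 ≤ (Q j).real (A j) ^ 2 := by
    have h1 := hlt' j
    rw [probReal_compl_eq_one_sub (hA j)] at h1
    gcongr
    linarith
  -- Any fixed index serves as reference law: the `A j` with `j ≠ o` are all errors under `Q o`, and
  -- each has mass of order at least `exp (-x) / M`.
  let o : Fin M := ⟨0, by omega⟩
  have hsum : ∑ j ∈ Finset.univ.erase o, (Q o).real (A j) ≤ (Q o).real (A o)ᶜ := by
    rw [← measureReal_biUnion_finset (fun i _ j _ hij => hd hij) fun j _ => hA j]
    refine measureReal_mono (Set.iUnion₂_subset fun j hj => ?_)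
    exact (hd (Finset.ne_of_mem_erase hj)).subset_compl_right
  have hcard : ∑ _j ∈ Finset.univ.erase o, (23 / 24 : ℝ) ^ 2 = (M - 1) * (23 / 24) ^ 2 := by
    rw [Finset.sum_const, Finset.card_erase_of_mem (Finset.mem_univ _), Finset.card_univ,
      Fintype.card_fin, nsmul_eq_mul, Nat.cast_sub (by omega), Nat.cast_one]
  have h1 : ((M : ℝ) - 1) * (23 / 24) ^ 2 ≤ (Q o).real (A o)ᶜ * (M * Real.exp x) := by
    rw [← hcard]
    calc _ ≤ ∑ j ∈ Finset.univ.erase o, (Q o).real (A j) * (M * Real.exp x) :=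
          Finset.sum_le_sum fun j hj => (hlow j).trans (hQ' j o (Finset.ne_of_mem_erase hj))
      _ ≤ _ := by
          rw [← Finset.sum_mul]
          gcongr
  have hMr : (2 : ℝ) ≤ M := by exact_mod_cast hM
  have h2 : (Q o).real (A o)ᶜ * (M * Real.exp x) ≤ M / 24 := by
    calc _ ≤ 1 / 24 * Real.exp (-x) * (M * Real.exp x) := by
          gcongr
          exact (hlt' o).le
      _ = M / 24 * (Real.exp (-x) * Real.exp x) := by ring
      _ = M / 24 := by rw [← Real.exp_add]; simp
  -- Contradiction: `(M - 1) * (23/24)²` exceeds `M / 24` once `M ≥ 2`.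
  linarith

/-! ### Step functions on a disjoint family of cells -/

/-- The function equal to `φ i` on the cell `C i` and to zero off all cells. -/
noncomputable def stepFun {E ι β : Type*} [Fintype ι] [AddCommMonoid β] (C : ι → Set E)
    (φ : ι → β) (u : E) : β :=
  ∑ i, (C i).indicator (fun _ => φ i) u

section StepFun

variable {E ι β γ : Type*} [Fintype ι] [AddCommMonoid β] [AddCommMonoid γ] {C : ι → Set E}

theorem stepFun_of_mem (hC : Pairwise (Function.onFun Disjoint C)) (φ : ι → β) {u : E} {i : ι}
    (hu : u ∈ C i) : stepFun C φ u = φ i := by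
  rw [stepFun, Finset.sum_eq_single i]
  · exact Set.indicator_of_mem hu _
  · exact fun j _ hji => Set.indicator_of_notMem
      (fun hj => Set.disjoint_left.1 (hC hji) hj hu) _
  · simp

theorem stepFun_of_forall_notMem (φ : ι → β) {u : E} (hu : ∀ i, u ∉ C i) :
    stepFun C φ u = 0 :=
  Finset.sum_eq_zero fun i _ => Set.indicator_of_notMem (hu i) _

theorem stepFun_comp (hC : Pairwise (Function.onFun Disjoint C)) (G : β → γ) (hG : G 0 = 0)
    (φ : ι → β) (u : E) : G (stepFun C φ u) = stepFun C (fun i => G (φ i)) u := by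
  by_cases h : ∃ i, u ∈ C i
  · obtain ⟨i, hi⟩ := h
    simp only [stepFun_of_mem hC _ hi]
  · push Not at h
    simp only [stepFun_of_forall_notMem _ h, hG]

theorem stepFun_comp₂ {δ : Type*} [AddCommMonoid δ] (hC : Pairwise (Function.onFun Disjoint C))
    (G : β → γ → δ) (hG : G 0 0 = 0) (φ : ι → β) (ψ : ι → γ) (u : E) :
    G (stepFun C φ u) (stepFun C ψ u) = stepFun C (fun i => G (φ i) (ψ i)) u := by
  by_cases h : ∃ i, u ∈ C i
  · obtain ⟨i, hi⟩ := h
    simp only [stepFun_of_mem hC _ hi]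
  · push Not at h
    simp only [stepFun_of_forall_notMem _ h, hG]

variable [MeasurableSpace E] (μ : Measure E)

theorem measurable_stepFun [MeasurableSpace β] [MeasurableAdd₂ β]
    (hm : ∀ i, MeasurableSet (C i)) (φ : ι → β) : Measurable (stepFun C φ) :=
  Finset.measurable_sum _ fun i _ => measurable_const.indicator (hm i)

theorem lintegral_stepFun (hm : ∀ i, MeasurableSet (C i)) (φ : ι → ℝ≥0∞) :
    ∫⁻ u, stepFun C φ u ∂μ = ∑ i, φ i * μ (C i) := by
  simp only [stepFun]
  rw [lintegral_finsetSum _ fun i _ => measurable_const.indicator (hm i)]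
  exact Finset.sum_congr rfl fun i _ => lintegral_indicator_const (hm i) _

theorem integral_stepFun (hm : ∀ i, MeasurableSet (C i)) (hf : ∀ i, μ (C i) ≠ ⊤) (φ : ι → ℝ) :
    ∫ u, stepFun C φ u ∂μ = ∑ i, μ.real (C i) * φ i := by
  simp only [stepFun]
  rw [integral_finsetSum _ fun i _ => (integrable_indicator_iff (hm i)).2 (integrableOn_const (hf i))]
  exact Finset.sum_congr rfl fun i _ => by rw [integral_indicator_const _ (hm i), smul_eq_mul]

theorem memLp_stepFun (p : ℝ≥0∞) (hm : ∀ i, MeasurableSet (C i)) (hf : ∀ i, μ (C i) ≠ ⊤)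
    (φ : ι → ℝ) : MemLp (stepFun C φ) p μ :=
  memLp_finsetSum _ fun i _ => memLp_indicator_const p (hm i) _ (Or.inr (hf i))

end StepFun

/-- Euclidean space contains any number of disjoint cells of a given volume. -/
theorem exists_disjoint_cells {d : ℕ} (hd : 1 ≤ d) (ι : Type*) [Fintype ι] {a : ℝ} (ha : 0 < a) :
    ∃ C : ι → Set (EuclideanSpace ℝ (Fin d)), (∀ i, MeasurableSet (C i)) ∧
      Pairwise (Function.onFun Disjoint C) ∧ ∀ i, volume (C i) = ENNReal.ofReal a := by
  classical
  let e := Fintype.equivFin ι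
  let o : Fin d := ⟨0, hd⟩
  -- Boxes of length `a` stacked along one coordinate, with unit sides in all others.
  let I : ι → Set ℝ := fun k => Set.Ico ((e k : ℕ) * a) (((e k : ℕ) + 1) * a)
  let B : ι → Set (Fin d → ℝ) := fun k =>
    Set.univ.pi (Function.update (fun _ => Set.Ico (0 : ℝ) 1) o (I k))
  have hB (k) : MeasurableSet (B k) := by
    refine MeasurableSet.univ_pi fun i => ?_
    by_cases hi : i = o
    · subst hi; simp [I]
    · simp [hi]
  have hmp := PiLp.volume_preserving_ofLp (Fin d)
  refine ⟨fun k => WithLp.ofLp ⁻¹' B k, fun k => hmp.measurable (hB k), fun j k hjk => ?_,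
    fun k => ?_⟩
  · refine Set.disjoint_left.2 fun u hj hk => hjk ?_
    have h1 := hj o trivial
    have h2 := hk o trivial
    simp only [Function.update_self, I, Set.mem_Ico] at h1 h2
    have h3 := lt_of_mul_lt_mul_right (h1.1.trans_lt h2.2) ha.le
    have h4 := lt_of_mul_lt_mul_right (h2.1.trans_lt h1.2) ha.le
    norm_cast at h3 h4
    exact e.injective (Fin.ext (by omega))
  · rw [hmp.measure_preimage (hB k).nullMeasurableSet, volume_pi_pi,
      ← Finset.mul_prod_erase _ _ (Finset.mem_univ o), Finset.prod_eq_one]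
    · simp only [Function.update_self, I, Real.volume_Ico, mul_one]
      congr 1
      ring
    · intro i hi
      simp [Finset.ne_of_mem_erase hi]

/-! ### Sums over sign vectors -/

section Signs

variable {M : ℕ}

/-- The sign of the coordinate `j`, as a real number. -/
def signAt (j : Fin M) (w : Fin M → ℤˣ) : ℝ := ((w j : ℤ) : ℝ)

theorem signAt_eq_or (j : Fin M) (w : Fin M → ℤˣ) : signAt j w = 1 ∨ signAt j w = -1 := by
  rcases Int.units_eq_one_or (w j) with h | h <;> simp [signAt, h]

theorem signAt_sq (j : Fin M) (w : Fin M → ℤˣ) : signAt j w ^ 2 = 1 := by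
  rcases signAt_eq_or j w with h | h <;> simp [h]

/-- Flipping the sign `j` is a bijection of the sign vectors. -/
theorem sum_eq_zero_of_flip (j : Fin M) {g : (Fin M → ℤˣ) → ℝ}
    (hg : ∀ w, g (w * Pi.mulSingle j (-1)) = -g w) : ∑ w, g w = 0 := by
  have h := Equiv.sum_comp (Equiv.mulRight (Pi.mulSingle j (-1) : Fin M → ℤˣ)) g
  simp only [Equiv.coe_mulRight, hg, Finset.sum_neg_distrib] at h
  linarith

theorem sum_signAt (j : Fin M) : ∑ w, signAt j w = 0 :=
  sum_eq_zero_of_flip j fun w => by simp [signAt]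

theorem sum_signAt_mul {j k : Fin M} (h : j ≠ k) : ∑ w, signAt j w * signAt k w = 0 :=
  sum_eq_zero_of_flip j fun w => by simp [signAt, Pi.mulSingle_eq_of_ne h.symm]

/-- Every function of two signs has this form, so integrals involving two dictionary members reduce
to a constant coefficient. -/
theorem sum_affine_signAt {j k : Fin M} (h : j ≠ k) (a b c e : ℝ) :
    ∑ w : Fin M → ℤˣ, (a + b * signAt j w + c * signAt k w + e * (signAt j w * signAt k w)) =
      2 ^ M * a := by
  simp only [Finset.sum_add_distrib, ← Finset.mul_sum, sum_signAt, sum_signAt_mul h]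
  simp

end Signs

/-! ### Densities that are constant on cells -/

theorem isProbabilityMeasure_withDensity_of_mem {d : ℕ} {L : ℝ} {f : L2Space d}
    (h : f ∈ boundedDensities d L) :
    IsProbabilityMeasure (volume.withDensity fun u => ENNReal.ofReal (f u)) :=
  ⟨by rw [withDensity_apply _ MeasurableSet.univ, setLIntegral_univ, h.2.1]⟩

section StepDensity

variable {d : ℕ} {ι : Type*} [Fintype ι] {C : ι → Set (EuclideanSpace ℝ (Fin d))}

/-- A step function on measurable cells of finite volume, as an element of `L²`. -/
noncomputable def stepLp (hm : ∀ i, MeasurableSet (C i)) (hf : ∀ i, volume (C i) ≠ ⊤)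
    (φ : ι → ℝ) : L2Space d :=
  (memLp_stepFun volume 2 hm hf φ).toLp (stepFun C φ)

variable (hm : ∀ i, MeasurableSet (C i)) (hf : ∀ i, volume (C i) ≠ ⊤)

theorem coeFn_stepLp (φ : ι → ℝ) : stepLp hm hf φ =ᵐ[volume] stepFun C φ :=
  MemLp.coeFn_toLp _

variable (hC : Pairwise (Function.onFun Disjoint C))
include hC

theorem norm_stepLp_sub_sq (φ ψ : ι → ℝ) :
    ‖stepLp hm hf φ - stepLp hm hf ψ‖ ^ 2 =
      ∑ i, volume.real (C i) * (φ i - ψ i) ^ 2 := by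
  rw [← real_inner_self_eq_norm_sq, L2.inner_def, ← integral_stepFun volume hm hf]
  refine integral_congr_ae ?_
  filter_upwards [coeFn_stepLp hm hf φ, coeFn_stepLp hm hf ψ,
    Lp.coeFn_sub (stepLp hm hf φ) (stepLp hm hf ψ)] with u h1 h2 h3
  rw [h3, Pi.sub_apply, h1, h2, real_inner_self_eq_norm_sq, Real.norm_eq_abs, sq_abs,
    stepFun_comp₂ hC (fun s t : ℝ => (s - t) ^ 2) (by simp)]

theorem supNormLE_stepLp {L : ℝ} (hL : 0 ≤ L) {φ : ι → ℝ} (h : ∀ i, |φ i| ≤ L) :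
    SupNormLE L (stepLp hm hf φ) := by
  refine (eLpNorm_congr_ae (coeFn_stepLp hm hf φ)).trans_le ?_
  rw [eLpNorm_exponent_top]
  refine eLpNormEssSup_le_of_ae_bound (ae_of_all _ fun u => ?_)
  by_cases hu : ∃ i, u ∈ C i
  · obtain ⟨i, hi⟩ := hu
    rw [stepFun_of_mem hC _ hi]
    exact h i
  · push Not at hu
    rw [stepFun_of_forall_notMem _ hu, norm_zero]
    exact hL

theorem withDensity_stepLp (φ : ι → ℝ) :
    (volume.withDensity fun u => ENNReal.ofReal (stepLp hm hf φ u)) =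
      volume.withDensity (stepFun C fun i => ENNReal.ofReal (φ i)) := by
  refine withDensity_congr_ae ?_
  filter_upwards [coeFn_stepLp hm hf φ] with u hu
  rw [hu, stepFun_comp hC ENNReal.ofReal ENNReal.ofReal_zero]

theorem stepLp_mem_boundedDensities {L : ℝ} (hL : 0 ≤ L) {φ : ι → ℝ} (h0 : ∀ i, 0 ≤ φ i)
    (h : ∀ i, φ i ≤ L) (h1 : ∑ i, volume.real (C i) * φ i = 1) :
    stepLp hm hf φ ∈ boundedDensities d L := by
  refine ⟨?_, ?_, supNormLE_stepLp hm hf hC hL fun i => by rw [abs_of_nonneg (h0 i)]; exact h i⟩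
  · filter_upwards [coeFn_stepLp hm hf φ] with u hu
    rw [hu]
    exact Finset.sum_nonneg fun i _ => Set.indicator_nonneg (fun _ _ => h0 i) _
  · rw [← setLIntegral_univ, ← withDensity_apply _ MeasurableSet.univ,
      withDensity_stepLp hm hf hC, withDensity_apply _ MeasurableSet.univ, setLIntegral_univ,
      lintegral_stepFun _ hm, ← ENNReal.ofReal_one, ← h1,
      ENNReal.ofReal_sum_of_nonneg fun i _ => mul_nonneg measureReal_nonneg (h0 i)]
    refine Finset.sum_congr rfl fun i _ => ?_
    rw [mul_comm, ENNReal.ofReal_mul measureReal_nonneg, ofReal_measureReal (hf i)]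

/-- Change of measure between two samples whose densities are constant on the same cells. -/
theorem sampleLaw_stepLp_sq_le {L : ℝ} (n : ℕ) {φ ψ : ι → ℝ} (hφ : ∀ i, 0 < φ i)
    (hψ : ∀ i, 0 < ψ i) (hφ1 : stepLp hm hf φ ∈ boundedDensities d L)
    (hψ1 : stepLp hm hf ψ ∈ boundedDensities d L)
    {A : Set (Fin n → EuclideanSpace ℝ (Fin d))} (hA : MeasurableSet A) :
    sampleLaw n (stepLp hm hf φ) A ^ 2 ≤ sampleLaw n (stepLp hm hf ψ) A *
      ENNReal.ofReal (∑ i, volume.real (C i) * (φ i ^ 2 / ψ i)) ^ n := by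
  have hP := isProbabilityMeasure_withDensity_of_mem hφ1
  have hQ := isProbabilityMeasure_withDensity_of_mem hψ1
  let ρ := stepFun C fun i => ENNReal.ofReal (φ i / ψ i)
  have hρ : Measurable ρ := measurable_stepFun hm _
  have hmψ : Measurable (stepFun C fun i => ENNReal.ofReal (ψ i)) := measurable_stepFun hm _
  have hPQ : (volume.withDensity fun u => ENNReal.ofReal (stepLp hm hf φ u)) =
      (volume.withDensity fun u => ENNReal.ofReal (stepLp hm hf ψ u)).withDensity ρ := by
    rw [withDensity_stepLp hm hf hC, withDensity_stepLp hm hf hC, ← withDensity_mul _ hmψ hρ]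
    congr 1
    funext u
    rw [Pi.mul_apply, stepFun_comp₂ hC (fun s t : ℝ≥0∞ => s * t) (by simp)]
    congr 1
    funext i
    rw [← ENNReal.ofReal_mul (hψ i).le, mul_div_cancel₀ _ (hψ i).ne']
  have hint : ∫⁻ u, ρ u ^ 2 ∂(volume.withDensity fun u => ENNReal.ofReal (stepLp hm hf ψ u)) =
      ENNReal.ofReal (∑ i, volume.real (C i) * (φ i ^ 2 / ψ i)) := by
    rw [withDensity_stepLp hm hf hC,
      lintegral_withDensity_eq_lintegral_mul _ hmψ (hρ.pow_const 2)]
    simp only [Pi.mul_apply, ρ]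
    simp only [stepFun_comp₂ hC (fun s t : ℝ≥0∞ => s * t ^ 2) (by simp)]
    rw [lintegral_stepFun _ hm, ENNReal.ofReal_sum_of_nonneg fun i _ =>
      mul_nonneg measureReal_nonneg (div_nonneg (sq_nonneg _) (hψ i).le)]
    refine Finset.sum_congr rfl fun i _ => ?_
    have h1 : φ i ^ 2 / ψ i = ψ i * (φ i / ψ i) ^ 2 := by
      have := (hψ i).ne'
      field_simp
    rw [mul_comm, ENNReal.ofReal_mul measureReal_nonneg, ofReal_measureReal (hf i), h1,
      ENNReal.ofReal_mul (hψ i).le, ENNReal.ofReal_pow (div_pos (hφ i) (hψ i)).le]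
  rw [hPQ] at hP
  rw [← hint, sampleLaw, hPQ]
  exact pi_withDensity_apply_sq_le _ hρ hA

end StepDensity

/-! ### Reduction of estimation to testing -/

theorem excessRisk_apply_self {d M : ℕ} (F : Fin M → L2Space d) (j : Fin M) (g : L2Space d) :
    excessRisk F (F j) g = ‖g - F j‖ ^ 2 := by
  have h : ⨅ k, ‖F k - F j‖ ^ 2 = 0 := by
    refine le_antisymm ?_ (Real.iInf_nonneg fun k => sq_nonneg _)
    refine (ciInf_le ⟨0, ?_⟩ j).trans_eq (by simp)
    rintro _ ⟨k, rfl⟩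
    exact sq_nonneg _
  rw [excessRisk, h, sub_zero]

/-- Densities with pairwise squared distance above `4 r` whose likelihood ratios have second
moment at most `M * exp x` cannot be estimated to within `r`. -/
theorem exists_le_sampleLaw_excessRisk {M n d : ℕ} (hM : 2 ≤ M) {L x r : ℝ} (hx : 0 ≤ x)
    (F : Fin M → L2Space d) (hF : ∀ j, F j ∈ boundedDensities d L)
    (hsep : ∀ j k, j ≠ k → 4 * r < ‖F j - F k‖ ^ 2)
    (hQ : ∀ j k, j ≠ k → ∀ A, MeasurableSet A →
      sampleLaw n (F j) A ^ 2 ≤ sampleLaw n (F k) A * ENNReal.ofReal (M * Real.exp x))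
    (T : (Fin n → EuclideanSpace ℝ (Fin d)) → L2Space d) (hT : IsEstimator T) :
    ∃ f ∈ boundedDensities d L, ENNReal.ofReal (1 / 24 * Real.exp (-x)) ≤
      sampleLaw n f {X | r < excessRisk F f (T X)} := by
  have hprob (j) : IsProbabilityMeasure (sampleLaw n (F j)) := by
    have := isProbabilityMeasure_withDensity_of_mem (hF j)
    unfold sampleLaw
    infer_instance
  let A : Fin M → Set (Fin n → EuclideanSpace ℝ (Fin d)) := fun j =>
    T ⁻¹' {g | ‖g - F j‖ ^ 2 ≤ r}
  have hA (j) : MeasurableSet (A j) := by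
    have hcl : IsClosed {g : L2Space d | ‖g - F j‖ ^ 2 ≤ r} :=
      isClosed_le (by fun_prop) continuous_const
    exact hT (MeasurableSpace.measurableSet_generateFrom hcl.isOpen_compl).of_compl
  have hdisj : Pairwise (Function.onFun Disjoint A) := by
    refine fun j k hjk => Set.disjoint_left.2 fun X (hj : ‖T X - F j‖ ^ 2 ≤ r)
      (hk : ‖T X - F k‖ ^ 2 ≤ r) => (hsep j k hjk).not_ge ?_
    have htri : ‖F j - F k‖ ≤ ‖T X - F j‖ + ‖T X - F k‖ := by
      rw [norm_sub_rev (T X) (F j)]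
      exact norm_sub_le_norm_sub_add_norm_sub _ _ _
    -- `(s + t)² ≤ 2 s² + 2 t² ≤ 4 r`.
    nlinarith [norm_nonneg (F j - F k), sq_nonneg (‖T X - F j‖ - ‖T X - F k‖)]
  obtain ⟨j, hj⟩ := exists_le_measure_compl hM hx (fun j => sampleLaw n (F j)) A hA hdisj
    fun j k hjk => hQ j k hjk _ (hA j)
  refine ⟨F j, hF j, hj.trans_eq ?_⟩
  congr 1
  ext X
  simp [A, excessRisk_apply_self]

/-! ### The sign-vector dictionary -/

theorem mainTheorem3 (M n d : ℕ) (hM : 2 ≤ M) (hn : 1 ≤ n) (hd : 1 ≤ d)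
    (L x : ℝ) (hL : 0 < L) (hx : 0 ≤ x) (hxn : (Real.log M + x) / n < 3) :
    ∃ F : Fin M → L2Space d, (∀ j, SupNormLE L (F j)) ∧
      ∀ T : (Fin n → EuclideanSpace ℝ (Fin d)) → L2Space d, IsEstimator T →
        ∃ f ∈ boundedDensities d L,
          ENNReal.ofReal (1 / 24 * Real.exp (-x)) ≤
            sampleLaw n f
              {X | L / 24 * ((Real.log M + x) / n) < excessRisk F f (T X)} := by
  have hMr : (2 : ℝ) ≤ M := by exact_mod_cast hM
  have hnr : (0 : ℝ) < n := by exact_mod_cast hn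
  set l : ℝ := (Real.log M + x) / n with hl
  have hl0 : 0 < l := div_pos (add_pos_of_pos_of_nonneg (Real.log_pos (by linarith)) hx) hnr
  -- Separation requires `L γ² > 4 * (L l / 24)`, that is `γ² > l / 6`; the value `l / 5` leaves
  -- room and still keeps the second moment below `1 + l`.
  set γ : ℝ := √(l / 5) with hγ
  have hγ2 : γ ^ 2 = l / 5 := Real.sq_sqrt (by positivity)
  have hγ0 : 0 < γ := Real.sqrt_pos.2 (by positivity)
  have hγ1 : γ < 1 := by nlinarith
  have hN : (0 : ℝ) < 2 ^ M := by positivity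
  obtain ⟨C, hm, hC, hvol⟩ := exists_disjoint_cells hd (Fin M → ℤˣ)
    (a := 2 / (L * 2 ^ M)) (by positivity)
  have hf (w) : volume (C w) ≠ ⊤ := by rw [hvol]; exact ENNReal.ofReal_ne_top
  have hvolr (w) : volume.real (C w) = 2 / (L * 2 ^ M) := by
    rw [measureReal_def, hvol, ENNReal.toReal_ofReal (by positivity)]
  let φ : Fin M → (Fin M → ℤˣ) → ℝ := fun j w => L / 2 * (1 + γ * signAt j w)
  have hφ0 (j w) : 0 < φ j w := by
    refine mul_pos (by positivity) ?_
    rcases signAt_eq_or j w with h | h <;> rw [h] <;> linarith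
  have hφL (j w) : φ j w ≤ L := by
    have : 1 + γ * signAt j w ≤ 2 := by
      rcases signAt_eq_or j w with h | h <;> rw [h] <;> linarith
    simp only [φ]
    nlinarith
  have hcell : 2 / (L * 2 ^ M) * 2 ^ M = 2 / L := by field_simp
  have hsum {j k : Fin M} (hjk : j ≠ k) (g : (Fin M → ℤˣ) → ℝ) (a b c e : ℝ)
      (hg : ∀ w, g w = a + b * signAt j w + c * signAt k w + e * (signAt j w * signAt k w)) :
      ∑ w, volume.real (C w) * g w = 2 / L * a := by
    simp only [hvolr, ← Finset.mul_sum, hg]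
    rw [sum_affine_signAt hjk, ← mul_assoc, hcell]
  have hφ1 (j) : ∑ w, volume.real (C w) * φ j w = 1 := by
    -- A dummy second index lets `hsum` apply to a function of one sign.
    have : Nontrivial (Fin M) := Fin.nontrivial_iff_two_le.2 hM
    obtain ⟨k, hk⟩ := exists_ne j
    rw [hsum hk.symm _ (L / 2) (L / 2 * γ) 0 0 fun w => by simp only [φ]; ring]
    field_simp
  let F : Fin M → L2Space d := fun j => stepLp hm hf (φ j)
  have hF (j) : F j ∈ boundedDensities d L :=
    stepLp_mem_boundedDensities hm hf hC hL.le (fun w => (hφ0 j w).le) (hφL j) (hφ1 j)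
  have hsep (j k) (hjk : j ≠ k) : 4 * (L / 24 * l) < ‖F j - F k‖ ^ 2 := by
    rw [norm_stepLp_sub_sq hm hf hC,
      hsum hjk _ (L ^ 2 / 2 * γ ^ 2) 0 0 (-(L ^ 2 / 2 * γ ^ 2)) fun w => ?_, hγ2]
    · have : 2 / L * (L ^ 2 / 2 * (l / 5)) = L * l / 5 := by field_simp
      rw [this]
      nlinarith [mul_pos hL hl0]
    · simp only [φ]
      linear_combination L ^ 2 / 4 * γ ^ 2 * (signAt_sq j w + signAt_sq k w)
  have hchi (j k) (hjk : j ≠ k) :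
      ∑ w, volume.real (C w) * (φ j w ^ 2 / φ k w) ≤ Real.exp l := by
    have hne : 0 < 1 - γ ^ 2 := by nlinarith
    -- Expansion of `(1 + γ σ_j)² / (1 + γ σ_k)`, using `σ² = 1` and `1 / (1 + γ σ_k) = (1 - γ σ_k)
    -- / (1 - γ²)`.
    rw [hsum hjk _ (L / 2 * ((1 + γ ^ 2) / (1 - γ ^ 2))) (L / 2 * (2 * γ / (1 - γ ^ 2)))
      (-(L / 2 * (γ * (1 + γ ^ 2) / (1 - γ ^ 2)))) (-(L / 2 * (2 * γ ^ 2 / (1 - γ ^ 2))))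
      fun w => ?_]
    · calc 2 / L * (L / 2 * ((1 + γ ^ 2) / (1 - γ ^ 2))) = (1 + γ ^ 2) / (1 - γ ^ 2) := by
            field_simp
        -- With `l = 5 γ²` this is `γ² ≤ 3/5`, which is where `l < 3` enters.
        _ ≤ l + 1 := by
            rw [div_le_iff₀ hne, hγ2]
            nlinarith
        _ ≤ Real.exp l := Real.add_one_le_exp l
    · rw [div_eq_iff (hφ0 k w).ne']
      simp only [φ]
      rcases signAt_eq_or j w with h | h <;> rcases signAt_eq_or k w with h' | h' <;>
        rw [h, h'] <;> field_simp <;> ring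
  refine ⟨F, fun j => (hF j).2.2, exists_le_sampleLaw_excessRisk hM hx F hF hsep
    fun j k hjk A hA => ?_⟩
  refine (sampleLaw_stepLp_sq_le hm hf hC n (hφ0 j) (hφ0 k) (hF j) (hF k) hA).trans ?_
  gcongr
  rw [← ENNReal.ofReal_pow (Finset.sum_nonneg fun w _ => mul_nonneg measureReal_nonneg
    (div_nonneg (sq_nonneg _) (hφ0 k w).le))]
  refine ENNReal.ofReal_le_ofReal ?_
  calc _ ≤ Real.exp l ^ n := by
        gcongr
        · exact Finset.sum_nonneg fun w _ => mul_nonneg measureReal_nonneg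
            (div_nonneg (sq_nonneg _) (hφ0 k w).le)
        · exact hchi j k hjk
    _ = M * Real.exp x := by
        rw [← Real.exp_nat_mul, hl, mul_div_cancel₀ _ hnr.ne', Real.exp_add,
          Real.exp_log (by linarith)]
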